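/- Let $M$ be a smooth, connected, finite-dimensional Riemannian manifold without boundary, not necessarily compact, with distance $d$, and let $X$ be a complete $C^1$ vector field on $M$ with flow $X_t$ and set of singularities (zeros) $\mathrm{Sing}(X)$. Definitions. Let $C^0_X(M)$ be the set of continuous functions $e\colon M\to[0,\infty)$ with $e^{-1}(0)=\mathrm{Sing}(X)$. For $e\in C^0_X(M)$, an $e$-$1$-pseudo-orbit is a finite or infinite sequence $(x_i,t_i)_{a}^{b}$ of points $x_i\in M$ and times $t_i\ge 1$, with $-\infty\le a\le 0\le b\le\infty$ and $a<b$, such that $d(X_{t_i}(x_i),x_{i+1})\le e(x_i)$ whenever $i$ and $i+1$ are both indices; it is in $\Lambda$ if all $x_i\in\Lambda$. Put $s_0=0$ and $s_{i+1}=s_i+t_i$. The pseudo-orbit is $e$-shadowed by $y$ if there is an increasing homeomorphism $h$ of $\mathbb R$ with $h(0)=0$ and $d(X_{h(t)}(y),X_{t-s_i}(x_i))\le e(X_{t-s_i}(x_i))$ for all $i$ and all $t\in[s_i,s_i+t_i)$. For a closed invariant set $\Lambda\subset M$, $X$ has the rescaled-shadowing property on $\Lambda$ if for every $e\in C^0_X(M)$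 there is $\delta\in C^0_X(M)$ such that every $\delta$-$1$-pseudo-orbit in $\Lambda$ is $e$-shadowed by some point of $\Lambda$. A closed invariant set $\Lambda$ is $R$-chain-recurrent if for every $x\in\Lambda$ and every $e\in C^0_X(M)$ there are $N\ge1$ and an $e$-$1$-pseudo-orbit $(x_i,t_i)_0^N$ in $\Lambda$ with $x_0=x_N=x$. A singularity $\sigma\in\Lambda$ is attached to $\Lambda$ if it is accumulated by regular (non-singular) points of $\Lambda$. It is hyperbolic if $T_\sigma M=E^s\oplus E^u$ with $E^s,E^u$ invariant under $DX(\sigma)$ and there are $C,\lambda>0$ with $\|e^{tDX(\sigma)}v\|\le Ce^{-\lambda t}\|v\|$ for $v\in E^s$ and $\|e^{-tDX(\sigma)}v\|\le Ce^{-\lambda t}\|v\|$ for $v\in E^u$, for all $t\ge0$; it is index-one (codimension-one) if moreover $\dim E^s=1$ or $\dim E^u=1$. Let $HL(\sigma)$ be the set of regular points $p$ with $X_t(p)\to\sigma$ both as $t\to+\infty$ and as $t\to-\infty$ (the points of the homoclinic loops of $\sigma$). A neighborhood $V$ of $\sigma$ is adapted if for every $p\in HL(\sigma)$ the orbit $O(p)$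 meets $\partial V$ in a finite set; the number of its points is denoted $n(p,V,\sigma)$. Theorem. Let $\Lambda$ be an $R$-chain-recurrent set. (1) If $\Lambda$ has an attached hyperbolic singularity $\sigma$ such that for every adapted neighborhood $V$ of $\sigma$ there is $N>0$ with $n(p,V,\sigma)\le N$ for all $p\in HL(\sigma)$, then $X$ does not have the rescaled-shadowing property on $\Lambda$. (2) If $\Lambda$ has an attached index-one hyperbolic singularity, then $X$ does not have the rescaled-shadowing property on $\Lambda$. (3) If $\dim M\le3$ and $\Lambda$ has an attached hyperbolic singularity, then $X$ does not have the rescaled-shadowing property on $\Lambda$. -/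

import Mathlib

open Set Filter Topology Manifold Bundle
open scoped ContDiff

noncomputable section

namespace RescaledShadowing

/-! ### Vector fields, flows, hyperbolic singularities

`M` is a manifold modelled on `ℝⁿ` (without boundary), `X` a vector field on `M`. -/

section VectorField

variable {n : ℕ} {M : Type*} [MetricSpace M] [ChartedSpace (EuclideanSpace ℝ (Fin n)) M]

/-- `X` is a complete vector field: through every point passes an integral curve that is defined
for all times. -/
def IsComplete (X : (x : M) → TangentSpace (𝓡 n) x) : Prop :=
  ∀ x : M, ∃ γ : ℝ → M, γ 0 = x ∧ IsMIntegralCurve γ X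

/-- The flow `(t, x) ↦ X_t(x)` of a complete vector field: `t ↦ X_t(x)` is the integral curve
of `X` that starts at `x` (it is unique when `X` is `C^1`). -/
def flow (X : (x : M) → TangentSpace (𝓡 n) x) (hX : IsComplete X) (t : ℝ) (x : M) : M :=
  (hX x).choose t

/-- The set of singularities (zeros) of `X`. -/
def Sing (X : (x : M) → TangentSpace (𝓡 n) x) : Set M := {x | X x = 0}

/-- The singularity `σ` is attached to `Λ`: it is accumulated by regular points of `Λ`. -/
def IsAttached (X : (x : M) → TangentSpace (𝓡 n) x) (Λ : Set M) (σ : M) : Prop :=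
  σ ∈ Sing X ∧ σ ∈ closure (Λ \ Sing X)

variable [IsManifold (𝓡 n) ∞ M]

/-- The derivative `DX(σ) : T_σ M → T_σ M` of the vector field `X` at `σ` (used where `X σ = 0`,
where it does not depend on the choice of coordinates): read `X` in the trivialization of the
tangent bundle given by the chart at `σ`, differentiate at `σ`, and transport the result back
to `T_σ M`. -/
def linearization (X : (x : M) → TangentSpace (𝓡 n) x) (σ : M) :
    TangentSpace (𝓡 n) σ →L[ℝ] TangentSpace (𝓡 n) σ :=
  let e := trivializationAt (EuclideanSpace ℝ (Fin n)) (TangentSpace (𝓡 n) : M → Type _) σ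
  (e.symmL ℝ σ).comp
    (mfderiv (𝓡 n) 𝓘(ℝ, EuclideanSpace ℝ (Fin n))
      (fun x : M => (e (⟨x, X x⟩ : TangentBundle (𝓡 n) M)).2) σ)

/-- The linear flow `DX_t = exp (t DX(σ))` on `T_σ M`. The exponential is taken in the algebra of
operators of `ℝⁿ`, which is the vector space underlying `T_σ M`. -/
def linearFlow (X : (x : M) → TangentSpace (𝓡 n) x) (σ : M) (t : ℝ) :
    TangentSpace (𝓡 n) σ →L[ℝ] TangentSpace (𝓡 n) σ :=
  NormedSpace.exp (𝔸 := EuclideanSpace ℝ (Fin n) →L[ℝ] EuclideanSpace ℝ (Fin n))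
    (t • linearization X σ)

variable [RiemannianBundle (fun x : M => TangentSpace (𝓡 n) x)]

/-- `T_σ M = Es ⊕ Eu` is a hyperbolic splitting for `X` at `σ`: both subspaces are invariant
under `DX(σ)`, and the linear flow `DX_t` contracts `Es` exponentially in the
future and `Eu` exponentially in the past. Norms are those of the Riemannian metric. -/
structure IsHyperbolicSplitting (X : (x : M) → TangentSpace (𝓡 n) x) (σ : M)
    (Es Eu : Submodule ℝ (TangentSpace (𝓡 n) σ)) : Prop where
  isCompl : IsCompl Es Eu
  invariant_stable : ∀ v ∈ Es, linearization X σ v ∈ Es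
  invariant_unstable : ∀ v ∈ Eu, linearization X σ v ∈ Eu
  exponential : ∃ C > (0 : ℝ), ∃ lam > (0 : ℝ), ∀ t : ℝ, 0 ≤ t →
    (∀ v ∈ Es, ‖linearFlow X σ t v‖ ≤ C * Real.exp (-lam * t) * ‖v‖) ∧
    (∀ v ∈ Eu, ‖linearFlow X σ (-t) v‖ ≤ C * Real.exp (-lam * t) * ‖v‖)

/-- `σ` is a hyperbolic singularity of `X`. -/
def IsHyperbolicSing (X : (x : M) → TangentSpace (𝓡 n) x) (σ : M) : Prop :=
  σ ∈ Sing X ∧ ∃ Es Eu, IsHyperbolicSplitting X σ Es Eu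

/-- `σ` is a hyperbolic singularity of index one (equivalently codimension one): its stable or its
unstable subspace has dimension one. -/
def IsIndexOneHyperbolicSing (X : (x : M) → TangentSpace (𝓡 n) x) (σ : M) : Prop :=
  σ ∈ Sing X ∧ ∃ Es Eu, IsHyperbolicSplitting X σ Es Eu ∧
    (Module.finrank ℝ Es = 1 ∨ Module.finrank ℝ Eu = 1)

end VectorField

/-! ### Dynamical notions

`φ t x` is the flow, `S` is its set of singularities. -/

section Dynamics

variable {M : Type*} [MetricSpace M]

/-- The orbit of `x`. -/
def orbit (φ : ℝ → M → M) (x : M) : Set M := range fun t => φ t x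

/-- `Λ` is invariant under the flow. -/
def IsInvariantSet (φ : ℝ → M → M) (Λ : Set M) : Prop := ∀ t, φ t '' Λ = Λ

/-- The stable set of `σ`. -/
def stableSet (φ : ℝ → M → M) (σ : M) : Set M :=
  {x | Tendsto (fun t => dist (φ t x) σ) atTop (𝓝 0)}

/-- The unstable set of `σ`. -/
def unstableSet (φ : ℝ → M → M) (σ : M) : Set M :=
  {x | Tendsto (fun t => dist (φ t x) σ) atBot (𝓝 0)}

/-- The set `HL(σ)` of homoclinic points: the regular points in `W^s(σ) ∩ W^u(σ)`, that is, the
points whose orbit is a homoclinic loop attached to `σ`. -/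
def HL (φ : ℝ → M → M) (S : Set M) (σ : M) : Set M :=
  (stableSet φ σ ∩ unstableSet φ σ) \ S

/-- `V` is an adapted neighbourhood of `σ`: every homoclinic loop attached to `σ` meets the
boundary of `V` in finitely many points. -/
def IsAdaptedNhd (φ : ℝ → M → M) (S : Set M) (σ : M) (V : Set M) : Prop :=
  V ∈ 𝓝 σ ∧ ∀ p ∈ HL φ S σ, (frontier V ∩ orbit φ p).Finite

/-- The crossing number `n(p, V, σ)` of the orbit of `p` with the boundary of `V`. -/
def crossingNumber (φ : ℝ → M → M) (V : Set M) (p : M) : ℕ :=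
  (frontier V ∩ orbit φ p).ncard

/-- The class `C^0_X(M)` of continuous functions `e ≥ 0` on `M` with `e⁻¹(0) = S`. -/
def IsScale (S : Set M) (e : M → ℝ) : Prop :=
  Continuous e ∧ (∀ x, 0 ≤ e x) ∧ e ⁻¹' {0} = S

/-- `(x_i, t_i)_{i ∈ J}` is an `e`-`T`-pseudo-orbit, where `J` is the finite or infinite integer
interval of its indices. `J` has at least two elements (`a < b`) and contains the index `0`
that carries the starting time. Values of `x` and `t` outside `J` are irrelevant. -/
structure IsPseudoOrbit (φ : ℝ → M → M) (e : M → ℝ) (T : ℝ) (J : Set ℤ)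
    (x : ℤ → M) (t : ℤ → ℝ) : Prop where
  ordConnected : J.OrdConnected
  nontrivial : J.Nontrivial
  zero_mem : (0 : ℤ) ∈ J
  le_time : ∀ i ∈ J, T ≤ t i
  jump : ∀ i ∈ J, i + 1 ∈ J → dist (φ (t i) (x i)) (x (i + 1)) ≤ e (x i)

/-- The times `s_i`: `s_0 = 0` and `s_{i+1} = s_i + t_i`. -/
def startTime (t : ℤ → ℝ) (i : ℤ) : ℝ :=
  ∑ j ∈ Finset.Ico 0 i, t j - ∑ j ∈ Finset.Ico i 0, t j

/-- The pseudo-orbit `(x_i, t_i)_{i ∈ J}` is `e`-shadowed by `y`: for some increasing homeomorphism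
`h` of `ℝ` with `h 0 = 0`, the point `X_{h(r)}(y)` is `e`-close to the point `X_{r - s_i}(x_i)` of
the pseudo-orbit for every `r ∈ [s_i, s_i + t_i)`. -/
def IsShadowedBy (φ : ℝ → M → M) (e : M → ℝ) (J : Set ℤ) (x : ℤ → M) (t : ℤ → ℝ) (y : M) :
    Prop :=
  ∃ h : ℝ ≃ₜ ℝ, StrictMono h ∧ h 0 = 0 ∧
    ∀ i ∈ J, ∀ r ∈ Ico (startTime t i) (startTime t i + t i),
      dist (φ (h r) y) (φ (r - startTime t i) (x i)) ≤ e (φ (r - startTime t i) (x i))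

/-- The rescaled-shadowing property on `Λ`. -/
def HasRescaledShadowing (φ : ℝ → M → M) (S Λ : Set M) : Prop :=
  ∀ e, IsScale S e → ∃ d, IsScale S d ∧
    ∀ (J : Set ℤ) (x : ℤ → M) (t : ℤ → ℝ), IsPseudoOrbit φ d 1 J x t → (∀ i ∈ J, x i ∈ Λ) →
      ∃ y ∈ Λ, IsShadowedBy φ e J x t y

/-- `Λ` is an `R`-chain-recurrent set: it is closed and invariant and, for every `e ∈ C^0_X(M)`,
every point of `Λ` can be joined to itself by a finite `e`-`1`-pseudo-orbit in `Λ`. -/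
def IsRChainRecurrentSet (φ : ℝ → M → M) (S Λ : Set M) : Prop :=
  IsClosed Λ ∧ IsInvariantSet φ Λ ∧
    ∀ p ∈ Λ, ∀ e, IsScale S e → ∃ (N : ℕ) (x : ℤ → M) (t : ℤ → ℝ),
      IsPseudoOrbit φ e 1 (Icc 0 (N : ℤ)) x t ∧ (∀ i ∈ Icc 0 (N : ℤ), x i ∈ Λ) ∧
        x 0 = p ∧ x N = p

end Dynamics

end RescaledShadowing

end

namespace RescaledShadowing

/-! ### Flows with a strict Lyapunov function near a fixed point -/

/-! All three parts are instances of one statement: an attached hyperbolic singularity σ rules out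
rescaled shadowing. Near σ a strict Lyapunov function L takes the place of invariant manifolds: on a
compact neighbourhood B it grows along orbits at least like a gauge N, the squared distance to σ in
a chart.

Shadowing breaks because a jump is measured at the start w of a piece and not at its end. If w lies
on the frontier of B, the permitted jump is at least some c > 0, however close to σ the piece ends
(`not_hasRescaledShadowing_of_exits`). Let it end at x ∈ Λ very near σ and jump to x' ∈ Λ within c/2
of σ but more than ten times farther from σ than x. Shadowing with precision a quarter of the
distance to the singularities would put one point close to both x and x', which is impossible.

Such pieces exist once backward orbits of points of Λ arbitrarily near σ leave B, and chain
recurrence forces this (`exists_exit_of_chainRecurrent`). Otherwise Λ near σ behaves like part of an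
unstable set: there L dominates N (`mul_gauge_le_of_backward`) and gains a fixed factor over any
time at least 1 (`growth_of_backward`). A pseudo-orbit with small jumps, followed backward from a
regular point p near σ, then keeps L strictly below L p and cannot start at p.

The function L is a quadratic form solving a Lyapunov inequality for DX(σ) (`exists_lyapunov_form`);
it survives the o(u) error of the nonlinear field (`exists_isLyapunovPair`). -/

theorem monotoneOn_of_hasDerivAt_nonneg {D : Set ℝ} (hD : Convex ℝ D) {f : ℝ → ℝ}
    (h : ∀ t ∈ D, ∃ f', HasDerivAt f f' t ∧ 0 ≤ f') : MonotoneOn f D := by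
  refine monotoneOn_of_deriv_nonneg hD ?_ ?_ ?_
  · intro t ht
    obtain ⟨f', hf, -⟩ := h t ht
    exact hf.continuousAt.continuousWithinAt
  · intro t ht
    obtain ⟨f', hf, -⟩ := h t (interior_subset ht)
    exact hf.differentiableAt.differentiableWithinAt
  · intro t ht
    obtain ⟨f', hf, hf0⟩ := h t (interior_subset ht)
    rwa [hf.deriv]

/-- A curve that starts in a closed set `B` and leaves it meets the boundary of `B` at a first exit
time. -/
theorem exists_first_exit {M : Type*} [TopologicalSpace M] {B : Set M} (hB : IsClosed B)
    {γ : ℝ → M} (hγ : Continuous γ) (h0 : γ 0 ∈ B) {t : ℝ} (ht : 0 ≤ t) (hout : γ t ∉ B) :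
    ∃ τ, 0 ≤ τ ∧ γ τ ∈ frontier B ∧ ∀ s ∈ Icc 0 τ, γ s ∈ B := by
  -- If the path missed the frontier, the interior and the complement of B would disconnect it.
  have key : ∀ s, 0 ≤ s → γ s ∉ B → ∃ u ∈ Icc 0 s, γ u ∈ frontier B := by
    intro s hs hsB
    have hpre : IsPreconnected (γ '' Icc 0 s) := isPreconnected_Icc.image _ hγ.continuousOn
    by_contra! hcon
    obtain ⟨z, -, hz, hz'⟩ := hpre (interior B) Bᶜ isOpen_interior hB.isOpen_compl
      (by
        rintro - ⟨u, hu, rfl⟩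
        by_cases huB : γ u ∈ B
        · refine Or.inl (by_contra fun hui => hcon u hu ?_)
          rw [hB.frontier_eq]
          exact ⟨huB, hui⟩
        · exact Or.inr huB)
      ⟨γ 0, mem_image_of_mem _ (left_mem_Icc.2 hs), by_contra fun hui =>
        hcon 0 (left_mem_Icc.2 hs) (hB.frontier_eq ▸ ⟨h0, hui⟩)⟩
      ⟨γ s, mem_image_of_mem _ (right_mem_Icc.2 hs), hsB⟩
    exact hz' (interior_subset hz)
  let A : Set ℝ := Ici 0 ∩ γ ⁻¹' frontier B
  have hA : IsClosed A := isClosed_Ici.inter (isClosed_frontier.preimage hγ)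
  obtain ⟨u, hu, hu'⟩ := key t ht hout
  have hbdd : BddBelow A := ⟨0, fun s hs => hs.1⟩
  have hmem : sInf A ∈ A := hA.csInf_mem ⟨u, hu.1, hu'⟩ hbdd
  refine ⟨sInf A, hmem.1, hmem.2, fun s hs => ?_⟩
  by_contra hsB
  obtain ⟨v, hv, hv'⟩ := key s hs.1 hsB
  have h1 : sInf A ≤ v := csInf_le hbdd ⟨hv.1, hv'⟩
  have h2 : s = sInf A := le_antisymm hs.2 (h1.trans hv.2)
  exact hsB (h2 ▸ hB.frontier_subset hmem.2)

variable {M : Type*} [MetricSpace M]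

/-- `φ` is a flow all of whose orbits are continuous, and `S` consists of fixed points of `φ`. -/
structure IsOrbitFlow (φ : ℝ → M → M) (S : Set M) : Prop where
  zero : ∀ x, φ 0 x = x
  add : ∀ s t x, φ s (φ t x) = φ (s + t) x
  continuous : ∀ x, Continuous fun t => φ t x
  fixed : ∀ x ∈ S, ∀ t, φ t x = x

/-- `L` is a strict Lyapunov function on the compact neighbourhood `B` of `σ`: along orbits in `B`
it grows at least at the rate `a * N`, where `N` is a gauge of the distance to `σ` whose
logarithmic derivative is bounded by `b`. -/
structure IsLyapunovPair (φ : ℝ → M → M) (σ : M) (B : Set M) (L N : M → ℝ) (a b C : ℝ) :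
    Prop where
  compact : IsCompact B
  mem_nhds : B ∈ 𝓝 σ
  a_pos : 0 < a
  b_pos : 0 < b
  C_pos : 0 < C
  continuousOn_L : ContinuousOn L B
  continuousOn_N : ContinuousOn N B
  nonneg : ∀ x ∈ B, 0 ≤ N x
  eq_zero_iff : ∀ x ∈ B, N x = 0 ↔ x = σ
  abs_L_le : ∀ x ∈ B, |L x| ≤ C * N x
  deriv_L : ∀ x t, φ t x ∈ B → ∃ l, HasDerivAt (fun s => L (φ s x)) l t ∧ a * N (φ t x) ≤ l
  deriv_N : ∀ x t, φ t x ∈ B → ∃ m, HasDerivAt (fun s => N (φ s x)) m t ∧ |m| ≤ b * N (φ t x)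

variable {φ : ℝ → M → M} {S : Set M} {σ : M} {B : Set M} {L N : M → ℝ} {a b C : ℝ}

/-! ### Escape from the neighbourhood and failure of shadowing -/

namespace IsLyapunovPair

/-- L is constant along a constant orbit, so the growth rate a * N must vanish there. Hence the
frontier of B contains no singularity. -/
theorem eq_of_mem_fixed (h : IsLyapunovPair φ σ B L N a b C) (hφ : IsOrbitFlow φ S)
    {x : M} (hx : x ∈ S) (hxB : x ∈ B) : x = σ := by
  obtain ⟨l, hl, hle⟩ := h.deriv_L x 0 (by rwa [hφ.zero])
  have h1 : (fun s => L (φ s x)) = fun _ => L x := by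
    funext s
    rw [hφ.fixed x hx]
  rw [h1] at hl
  have h2 : l = 0 := hl.unique (hasDerivAt_const 0 (L x))
  rw [hφ.zero, h2] at hle
  have h3 := h.a_pos
  have h4 := h.nonneg x hxB
  exact (h.eq_zero_iff x hxB).1 (le_antisymm (by nlinarith) h4)

theorem gauge_self (h : IsLyapunovPair φ σ B L N a b C) : N σ = 0 :=
  (h.eq_zero_iff σ (mem_of_mem_nhds h.mem_nhds)).2 rfl

theorem tendsto_gauge (h : IsLyapunovPair φ σ B L N a b C) : Tendsto N (𝓝 σ) (𝓝 0) := by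
  have := h.continuousOn_N.continuousAt h.mem_nhds
  rwa [ContinuousAt, h.gauge_self] at this

theorem notMem_frontier (h : IsLyapunovPair φ σ B L N a b C) : σ ∉ frontier B := fun hσ =>
  hσ.2 (mem_interior_iff_mem_nhds.2 h.mem_nhds)

/-- By the bound on N', the product exp(bt) N is nondecreasing along the orbit. This makes the
passage from the frontier of B to a point very near σ last at least time 1. -/
theorem gauge_backward_le (h : IsLyapunovPair φ σ B L N a b C) (hφ : IsOrbitFlow φ S) {x : M}
    {τ : ℝ} (hτ : 0 ≤ τ) (hx : ∀ s ∈ Icc 0 τ, φ (-s) x ∈ B) :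
    N (φ (-τ) x) ≤ Real.exp (b * τ) * N x := by
  have hmono : MonotoneOn (fun t => Real.exp (b * t) * N (φ t x)) (Icc (-τ) 0) := by
    refine monotoneOn_of_hasDerivAt_nonneg (convex_Icc _ _) fun t ht => ?_
    have htB : φ t x ∈ B := by
      simpa using hx (-t) ⟨by linarith [ht.2], by linarith [ht.1]⟩
    obtain ⟨m, hm, hmb⟩ := h.deriv_N x t htB
    have he : HasDerivAt (fun t => Real.exp (b * t)) (Real.exp (b * t) * (b * 1)) t :=
      ((hasDerivAt_id t).const_mul b).exp
    refine ⟨_, he.mul hm, ?_⟩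
    have h1 := (abs_le.1 hmb).1
    have : Real.exp (b * t) * (b * 1) * N (φ t x) + Real.exp (b * t) * m
        = Real.exp (b * t) * (b * N (φ t x) + m) := by ring
    rw [this]
    exact mul_nonneg (Real.exp_pos _).le (by linarith)
  have h1 := hmono (left_mem_Icc.2 (by linarith)) (right_mem_Icc.2 (by linarith))
    (show -τ ≤ 0 by linarith)
  simp only [mul_zero, Real.exp_zero, one_mul, hφ.zero] at h1
  calc N (φ (-τ) x) = Real.exp (b * τ) * (Real.exp (b * -τ) * N (φ (-τ) x)) := by
        rw [← mul_assoc, ← Real.exp_add]; simp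
    _ ≤ _ := mul_le_mul_of_nonneg_left h1 (Real.exp_pos _).le

/-- If backward orbits of points of `Λ` arbitrarily close to `σ` leave `B`, then rescaled shadowing
fails on `Λ`: pass very close to `σ` and jump to a point of `Λ` much farther from `σ`. -/
theorem not_hasRescaledShadowing_of_exits (h : IsLyapunovPair φ σ B L N a b C)
    (hφ : IsOrbitFlow φ S) (hS : IsClosed S) (hσ : σ ∈ S) {Λ : Set M} (hΛ : IsInvariantSet φ Λ)
    (hexit : ∀ U ∈ 𝓝 σ, ∃ x ∈ U, x ∈ Λ ∧ ∃ t, 0 ≤ t ∧ φ (-t) x ∉ B) :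
    ¬ HasRescaledShadowing φ S Λ := by
  intro hsh
  have hBcl := h.compact.isClosed
  have hscale : IsScale S fun x => Metric.infDist x S / 4 := by
    refine ⟨(Metric.continuous_infDist_pt S).div_const 4,
      fun x => div_nonneg Metric.infDist_nonneg (by norm_num), ?_⟩
    ext x
    rw [mem_preimage, mem_singleton_iff, hS.mem_iff_infDist_zero ⟨σ, hσ⟩]
    constructor <;> intro hx <;> linarith
  obtain ⟨δ, hδ, hshadow⟩ := hsh _ hscale
  have hpos : ∀ x ∈ frontier B, 0 < δ x := by
    intro x hx
    refine lt_of_le_of_ne (hδ.2.1 x) fun h0 => h.notMem_frontier ?_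
    have hxS : x ∈ S := by
      rw [← hδ.2.2]
      exact h0.symm
    rwa [← h.eq_of_mem_fixed hφ hxS (hBcl.frontier_subset hx)]
  have hK : IsCompact (frontier B) := h.compact.of_isClosed_subset isClosed_frontier
    hBcl.frontier_subset
  -- c is the jump allowed from every starting point on the frontier of B.
  obtain ⟨c, hc, hcK⟩ : ∃ c > 0, ∀ x ∈ frontier B, c ≤ δ x := by
    rcases (frontier B).eq_empty_or_nonempty with he | hne
    · exact ⟨1, one_pos, by simp [he]⟩
    · obtain ⟨x, hx, hmin⟩ := hK.exists_isMinOn hne hδ.1.continuousOn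
      exact ⟨δ x, hpos x hx, fun y hy => hmin hy⟩
  obtain ⟨m, hm, hmK⟩ : ∃ m > 0, ∀ x ∈ frontier B, m ≤ N x := by
    rcases (frontier B).eq_empty_or_nonempty with he | hne
    · exact ⟨1, one_pos, by simp [he]⟩
    · obtain ⟨x, hx, hmin⟩ := hK.exists_isMinOn hne
        (h.continuousOn_N.mono hBcl.frontier_subset)
      have hxB := hBcl.frontier_subset hx
      refine ⟨N x, lt_of_le_of_ne (h.nonneg x hxB) fun h0 => h.notMem_frontier ?_,
        fun y hy => hmin hy⟩
      rwa [← (h.eq_zero_iff x hxB).1 h0.symm]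
  -- The target x' is fixed first, so that x can be taken close to σ relative to x'.
  obtain ⟨x', hx'c, hx'Λ, t', -, hx't⟩ := hexit _ (Metric.ball_mem_nhds σ (half_pos hc))
  have hx'σ : 0 < dist x' σ := by
    refine dist_pos.2 fun he => hx't ?_
    rw [he, hφ.fixed σ hσ]
    exact mem_of_mem_nhds h.mem_nhds
  have hsmall : ∀ᶠ x in 𝓝 σ, x ∈ B ∧ dist x σ < c / 2 ∧ dist x σ < dist x' σ / 10 ∧
      N x < m * Real.exp (-b) := by
    refine Filter.Eventually.and h.mem_nhds (Filter.Eventually.and ?_ (Filter.Eventually.and ?_ ?_))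
    · exact Metric.ball_mem_nhds σ (half_pos hc)
    · exact Metric.ball_mem_nhds σ (by positivity)
    · exact h.tendsto_gauge.eventually (gt_mem_nhds (by positivity))
  obtain ⟨x, ⟨hxB, hxc, hxx', hxN⟩, hxΛ, t, ht, hxt⟩ := hexit _ hsmall
  obtain ⟨τ, hτ, hτK, hτB⟩ := exists_first_exit hBcl ((hφ.continuous x).comp continuous_neg)
    (by simpa [hφ.zero] using hxB) ht hxt
  simp only [Function.comp_apply] at hτK hτB
  have hτ1 : 1 ≤ τ := by
    by_contra hlt
    have h1 := h.gauge_backward_le hφ hτ hτB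
    have h2 : Real.exp (b * τ) ≤ Real.exp b :=
      Real.exp_le_exp.2 (by nlinarith [h.b_pos])
    have h3 : Real.exp (b * τ) * N x ≤ Real.exp b * N x :=
      mul_le_mul_of_nonneg_right h2 (h.nonneg x hxB)
    have h4 : Real.exp b * N x < Real.exp b * (m * Real.exp (-b)) :=
      mul_lt_mul_of_pos_left hxN (Real.exp_pos b)
    have h5 : Real.exp b * (m * Real.exp (-b)) = m := by
      rw [mul_comm m, ← mul_assoc, ← Real.exp_add]; simp
    linarith [hmK _ hτK]
  set w := φ (-τ) x with hw
  have hwx : φ τ w = x := by rw [hw, hφ.add]; simp [hφ.zero]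
  have hwΛ : w ∈ Λ := by
    rw [← hΛ (-τ)]
    exact mem_image_of_mem _ hxΛ
  -- Two pieces: from w to x in time τ, then from x' in time 1. The jump from x to x' is compared
  -- with δ at w.
  have hporbit : IsPseudoOrbit φ δ 1 (Icc 0 1) (fun i => if i = 0 then w else x')
      (fun i => if i = 0 then τ else 1) := by
    refine ⟨ordConnected_Icc, ⟨0, by simp, 1, by simp, by simp⟩, by simp, ?_, ?_⟩
    · intro i _
      split_ifs
      · exact hτ1
      · exact le_rfl
    · intro i hi hi1
      have hi0 : i = 0 := by
        have := hi.1
        have := hi1.2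
        lia
      subst hi0
      simp only [if_true, zero_add, one_ne_zero, if_false, hwx]
      calc dist x x' ≤ dist x σ + dist x' σ := dist_triangle_right _ _ _
        _ ≤ c := by linarith [Metric.mem_ball.1 hx'c]
        _ ≤ δ w := hcK _ hτK
  obtain ⟨y, -, g, -, -, hg⟩ := hshadow _ _ _ hporbit (by
    intro i _
    split_ifs
    · exact hwΛ
    · exact hx'Λ)
  have hs0 : startTime (fun i : ℤ => if i = 0 then τ else 1) 0 = 0 := by simp [startTime]
  have hs1 : startTime (fun i : ℤ => if i = 0 then τ else 1) 1 = τ := by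
    have : Finset.Ico (0 : ℤ) 1 = {0} := by decide
    simp [startTime, this]
  have hd : ∀ z, Metric.infDist z S ≤ dist z σ := fun z => Metric.infDist_le_dist_of_mem hσ
  have hright : dist (φ (g τ) y) x' ≤ dist x' σ / 4 := by
    have h1 := hg 1 (by simp) τ (by simp [hs1])
    simp only [hs1, sub_self, one_ne_zero, if_false, hφ.zero] at h1
    linarith [hd x']
  -- Shadowing controls the first piece only on [0, τ); continuity extends the bound to τ, where the
  -- second piece begins.
  have hleft : dist (φ (g τ) y) x ≤ dist x σ / 4 := by
    have hev : ∀ r ∈ Ico 0 τ, dist (φ (g r) y) (φ r w) ≤ Metric.infDist (φ r w) S / 4 := by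
      intro r hr
      have h1 := hg 0 (by simp) r (by simpa [hs0] using hr)
      simpa [hs0] using h1
    have hcl : IsClosed {r | dist (φ (g r) y) (φ r w) ≤ Metric.infDist (φ r w) S / 4} := by
      have c1 : Continuous fun r => φ (g r) y := (hφ.continuous y).comp g.continuous
      have c2 : Continuous fun r => φ r w := hφ.continuous w
      exact isClosed_le (c1.dist c2) (((Metric.continuous_infDist_pt S).comp c2).div_const 4)
    have h1 : τ ∈ closure (Ico 0 τ) := by
      rw [closure_Ico (by linarith)]
      exact right_mem_Icc.2 hτ
    have h2 : dist (φ (g τ) y) (φ τ w) ≤ Metric.infDist (φ τ w) S / 4 :=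
      closure_minimal hev hcl h1
    rw [hwx] at h2
    linarith [hd x]
  have h1 : dist x' σ ≤ dist (φ (g τ) y) x' + dist (φ (g τ) y) x + dist x σ := by
    have h3 := dist_triangle x' (φ (g τ) y) σ
    have h2 := dist_triangle (φ (g τ) y) x σ
    rw [dist_comm x' (φ (g τ) y)] at h3
    linarith
  linarith

/-- L - (a/b) N is nondecreasing along the orbit, and it comes arbitrarily close to 0 at suitable
past times because |L| ≤ C N. -/
theorem mul_gauge_le_of_backward (h : IsLyapunovPair φ σ B L N a b C) (hφ : IsOrbitFlow φ S)
    {x : M} (hx : ∀ t, 0 ≤ t → φ (-t) x ∈ B) : a / b * N x ≤ L x := by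
  have ha := h.a_pos
  have hb := h.b_pos
  have hC := h.C_pos
  have hB : ∀ t ∈ Iic (0 : ℝ), φ t x ∈ B := fun t ht => by simpa using hx (-t) (by simpa using ht)
  have hxB : x ∈ B := by simpa [hφ.zero] using hB 0 (by simp)
  have hmono : MonotoneOn (fun t => L (φ t x) - a / b * N (φ t x)) (Iic 0) := by
    refine monotoneOn_of_hasDerivAt_nonneg (convex_Iic _) fun t ht => ?_
    obtain ⟨l, hl, hle⟩ := h.deriv_L x t (hB t ht)
    obtain ⟨m, hm, hmb⟩ := h.deriv_N x t (hB t ht)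
    refine ⟨_, hl.sub (hm.const_mul (a / b)), ?_⟩
    have h1 : a / b * m ≤ a / b * (b * N (φ t x)) :=
      mul_le_mul_of_nonneg_left ((le_abs_self m).trans hmb) (by positivity)
    have h2 : a / b * (b * N (φ t x)) = a * N (φ t x) := by field_simp
    linarith
  -- the gauge is not bounded away from `0` on the backward orbit
  have hinf : ∀ ε > 0, ∃ t ≤ 0, N (φ t x) < ε := by
    intro ε hε
    by_contra! hcon
    obtain ⟨D, hD⟩ := h.compact.exists_bound_of_continuousOn h.continuousOn_L
    have hlin : MonotoneOn (fun t => L (φ t x) - a * ε * t) (Iic 0) := by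
      refine monotoneOn_of_hasDerivAt_nonneg (convex_Iic _) fun t ht => ?_
      obtain ⟨l, hl, hle⟩ := h.deriv_L x t (hB t ht)
      refine ⟨_, hl.sub ((hasDerivAt_id t).const_mul (a * ε)), ?_⟩
      have := mul_le_mul_of_nonneg_left (hcon t ht) ha.le
      linarith
    have hD0 : 0 ≤ D := (norm_nonneg _).trans (hD x hxB)
    -- Over a time (2D + 1)/(aε) the function L would change by at least 2D + 1, against |L| ≤ D on
    -- B.
    have hT : -((2 * D + 1) / (a * ε)) ≤ 0 := by
      have : 0 ≤ (2 * D + 1) / (a * ε) := by positivity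
      linarith
    have h1 := hlin hT (self_mem_Iic (a := (0 : ℝ))) hT
    have h2 : a * ε * -((2 * D + 1) / (a * ε)) = -(2 * D + 1) := by field_simp
    simp only [h2, mul_zero, hφ.zero] at h1
    have h3 := abs_le.1 (hD x hxB)
    have h4 := abs_le.1 (hD _ (hB _ hT))
    linarith [h3.2, h4.1]
  have hnon : ∀ ε > 0, 0 ≤ L x - a / b * N x + ε := by
    intro ε hε
    have hk : 0 < C + a / b := by positivity
    obtain ⟨t, ht, hNt⟩ := hinf (ε / (C + a / b)) (by positivity)
    have h1 := hmono ht (self_mem_Iic (a := (0 : ℝ))) ht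
    simp only [hφ.zero] at h1
    have h2 := (abs_le.1 (h.abs_L_le _ (hB t ht))).1
    have h3 : (C + a / b) * N (φ t x) < ε := by
      rwa [lt_div_iff₀ hk, mul_comm] at hNt
    linarith
  have := le_of_forall_pos_le_add fun ε hε => show 0 ≤ L x - a / b * N x + ε from hnon ε hε
  linarith

/-- L is nonnegative and nondecreasing on the backward orbit, and L' ≥ a N ≥ (a/C) L; integrating
from the lower bound L(φ(-t)x) over a time at least 1 gives the factor. -/
theorem growth_of_backward (h : IsLyapunovPair φ σ B L N a b C) (hφ : IsOrbitFlow φ S)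
    {x : M} (hx : ∀ t, 0 ≤ t → φ (-t) x ∈ B) {t : ℝ} (ht : 1 ≤ t) :
    (1 + a / C) * L (φ (-t) x) ≤ L x := by
  have ha := h.a_pos
  have hb := h.b_pos
  have hC := h.C_pos
  have hB : ∀ t ∈ Iic (0 : ℝ), φ t x ∈ B := fun t ht => by simpa using hx (-t) (by simpa using ht)
  have hmonoL : MonotoneOn (fun t => L (φ t x)) (Iic 0) := by
    refine monotoneOn_of_hasDerivAt_nonneg (convex_Iic _) fun t ht => ?_
    obtain ⟨l, hl, hle⟩ := h.deriv_L x t (hB t ht)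
    exact ⟨l, hl, (mul_nonneg ha.le (h.nonneg _ (hB t ht))).trans hle⟩
  have ht0 : -t ≤ 0 := by linarith
  set ℓ := L (φ (-t) x) with hℓ
  have hℓ0 : 0 ≤ ℓ := by
    refine le_trans (mul_nonneg (by positivity) (h.nonneg _ (hB _ ht0)))
      (h.mul_gauge_le_of_backward hφ fun s hs => ?_)
    rw [hφ.add]
    exact hB _ (by simp only [mem_Iic]; linarith)
  have hmono : MonotoneOn (fun s => L (φ s x) - a / C * ℓ * s) (Icc (-t) 0) := by
    refine monotoneOn_of_hasDerivAt_nonneg (convex_Icc _ _) fun s hs => ?_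
    obtain ⟨l, hl, hle⟩ := h.deriv_L x s (hB s hs.2)
    refine ⟨_, hl.sub ((hasDerivAt_id s).const_mul (a / C * ℓ)), ?_⟩
    have h1 : ℓ ≤ L (φ s x) := hmonoL ht0 hs.2 hs.1
    have h2 := (le_abs_self _).trans (h.abs_L_le _ (hB s hs.2))
    have h3 : a / C * ℓ ≤ a / C * (C * N (φ s x)) :=
      mul_le_mul_of_nonneg_left (h1.trans h2) (by positivity)
    have h4 : a / C * (C * N (φ s x)) = a * N (φ s x) := by field_simp
    linarith
  have h1 := hmono (left_mem_Icc.2 ht0) (right_mem_Icc.2 ht0) ht0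
  simp only [mul_zero, hφ.zero, ← hℓ] at h1
  have h2 : a / C * ℓ * 1 ≤ a / C * ℓ * t := mul_le_mul_of_nonneg_left ht (by positivity)
  linarith

/-- In an `R`-chain-recurrent set that accumulates at `σ`, the backward orbits of points
arbitrarily close to `σ` leave `B`. -/
theorem exists_exit_of_chainRecurrent (h : IsLyapunovPair φ σ B L N a b C)
    (hφ : IsOrbitFlow φ S) (hS : IsClosed S) (hσ : σ ∈ S) {Λ : Set M}
    (hΛ : IsRChainRecurrentSet φ S Λ) (hatt : σ ∈ closure (Λ \ S)) :
    ∀ U ∈ 𝓝 σ, ∃ x ∈ U, x ∈ Λ ∧ ∃ t, 0 ≤ t ∧ φ (-t) x ∉ B := by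
  by_contra! hcon
  obtain ⟨U, hU, hback⟩ := hcon
  have ha := h.a_pos
  have hb := h.b_pos
  have hC := h.C_pos
  obtain ⟨ε, hε, hεU⟩ := Metric.mem_nhds_iff.1 hU
  -- A value of N below m confines a point of B to the ball of radius ε/2. Where L ≥ (a/b) N, a
  -- value of L below (a/b) m does the same.
  obtain ⟨m, hm, hmB⟩ : ∃ m > 0, ∀ x ∈ B, ε / 2 ≤ dist x σ → m ≤ N x := by
    have hcomp : IsCompact (B ∩ {x | ε / 2 ≤ dist x σ}) :=
      h.compact.inter_right (isClosed_le continuous_const (continuous_id.dist continuous_const))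
    rcases (B ∩ {x | ε / 2 ≤ dist x σ}).eq_empty_or_nonempty with he | hne
    · exact ⟨1, one_pos, fun x hx hx' => absurd (show x ∈ B ∩ _ from ⟨hx, hx'⟩)
        (by rw [he]; exact notMem_empty x)⟩
    · obtain ⟨x, hx, hmin⟩ := hcomp.exists_isMinOn hne (h.continuousOn_N.mono inter_subset_left)
      refine ⟨N x, lt_of_le_of_ne (h.nonneg x hx.1) fun h0 => ?_, fun y hy hy' => hmin ⟨hy, hy'⟩⟩
      have h1 : ε / 2 ≤ dist x σ := hx.2
      rw [(h.eq_zero_iff x hx.1).1 h0.symm, dist_self] at h1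
      linarith
  have hsmall : ∀ᶠ x in 𝓝 σ, x ∈ U ∧ x ∈ B ∧ C * N x < a / b * m := by
    have h1 : Tendsto (fun x => C * N x) (𝓝 σ) (𝓝 0) := by
      simpa using h.tendsto_gauge.const_mul C
    exact Filter.Eventually.and hU
      (Filter.Eventually.and h.mem_nhds (h1.eventually (gt_mem_nhds (by positivity))))
  obtain ⟨p, ⟨hpU, hpB, hpN⟩, hpΛ, hpS⟩ := mem_closure_iff_nhds.1 hatt _ hsmall
  have hpback := hback p hpU hpΛ
  set ℓ := L p with hℓ
  have hNp : 0 < N p := lt_of_le_of_ne (h.nonneg p hpB) fun h0 =>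
    hpS ((h.eq_zero_iff p hpB).1 h0.symm ▸ hσ)
  have hℓ0 : 0 < ℓ := lt_of_lt_of_le (by positivity) (h.mul_gauge_le_of_backward hφ hpback)
  have hℓm : ℓ < a / b * m := ((le_abs_self _).trans (h.abs_L_le p hpB)).trans_lt hpN
  have hωpos : 0 < a / C * ℓ := by positivity
  obtain ⟨c, hc, hcL⟩ := Metric.uniformContinuousOn_iff.1
    (h.compact.uniformContinuousOn_of_continuous h.continuousOn_L) (a / C * ℓ) hωpos
  -- The half ε/2 keeps the point before a jump in U; the half c/2 keeps the change of L below (a/C)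
  -- ℓ, the gain of one piece.
  let c₀ := min (ε / 2) (c / 2)
  have hc₀ : 0 < c₀ := lt_min (half_pos hε) (half_pos hc)
  have hscale : IsScale S fun x => min (Metric.infDist x S) c₀ := by
    refine ⟨(Metric.continuous_infDist_pt S).min continuous_const,
      fun x => le_min Metric.infDist_nonneg hc₀.le, ?_⟩
    ext x
    rw [mem_preimage, mem_singleton_iff, hS.mem_iff_infDist_zero ⟨σ, hσ⟩]
    constructor
    · intro hx
      rcases min_choice (Metric.infDist x S) c₀ with h1 | h1 <;> rw [h1] at hx
      · exact hx
      · exact absurd hx hc₀.ne'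
    · intro hx
      rw [hx, min_eq_left hc₀.le]
  obtain ⟨n, x, t, hpo, hxΛ, hx0, hxn⟩ := hΛ.2.2 p hpΛ _ hscale
  -- Backward induction step: before the jump L is below (1 + a/C) ℓ, and going back along the piece
  -- divides by at least 1 + a/C. The inequality becomes strict even if L equals ℓ at the later
  -- point, as at p.
  have step : ∀ i ∈ Icc (0 : ℤ) n, i + 1 ∈ Icc (0 : ℤ) n →
      (∀ s, 0 ≤ s → φ (-s) (x (i + 1)) ∈ B) → L (x (i + 1)) ≤ ℓ →
      (∀ s, 0 ≤ s → φ (-s) (x i) ∈ B) ∧ L (x i) < ℓ := by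
    intro i hi hi1 hD hLi
    have hxB : x (i + 1) ∈ B := by simpa [hφ.zero] using hD 0 le_rfl
    have hnear : dist (x (i + 1)) σ < ε / 2 := by
      by_contra! hfar
      have h1 := h.mul_gauge_le_of_backward hφ hD
      have h2 : a / b * m ≤ a / b * N (x (i + 1)) :=
        mul_le_mul_of_nonneg_left (hmB _ hxB hfar) (by positivity)
      linarith
    have hjump := (hpo.jump i hi hi1).trans (min_le_right _ _)
    set y := φ (t i) (x i) with hy
    have hyU : y ∈ U := by
      refine hεU (Metric.mem_ball.2 ?_)
      calc dist y σ ≤ dist y (x (i + 1)) + dist (x (i + 1)) σ := dist_triangle _ _ _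
        _ < ε := by linarith [min_le_left (ε / 2) (c / 2)]
    have hyΛ : y ∈ Λ := by
      rw [← hΛ.2.1 (t i)]
      exact mem_image_of_mem _ (hxΛ i hi)
    have hyD := hback y hyU hyΛ
    have hti := hpo.le_time i hi
    have hxi : φ (-(t i)) y = x i := by
      rw [hy, hφ.add]; simp [hφ.zero]
    have hgrow := h.growth_of_backward hφ hyD hti
    rw [hxi] at hgrow
    have hyB : y ∈ B := by simpa [hφ.zero] using hyD 0 le_rfl
    have hLy : dist (L y) (L (x (i + 1))) < a / C * ℓ :=
      hcL y hyB _ hxB (by linarith [min_le_right (ε / 2) (c / 2)])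
    rw [Real.dist_eq, abs_lt] at hLy
    have hk : 0 < a / C := by positivity
    refine ⟨fun s hs => ?_, by nlinarith [hLy.2]⟩
    rw [← hxi, hφ.add, ← neg_add]
    exact hyD _ (by linarith)
  have hn : 0 < n := by
    obtain ⟨i, hi, j, hj, hij⟩ := hpo.nontrivial
    have := hi.1; have := hi.2; have := hj.1; have := hj.2
    lia
  have main : ∀ k : ℕ, k < n →
      (∀ s, 0 ≤ s → φ (-s) (x ((n : ℤ) - 1 - k)) ∈ B) ∧ L (x ((n : ℤ) - 1 - k)) < ℓ := by
    intro k
    induction k with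
    | zero =>
      intro _
      have he : (n : ℤ) - 1 - (0 : ℕ) + 1 = n := by simp
      refine step _ ⟨by simp; lia, by simp⟩ (by rw [he]; simp) ?_ ?_
      · rw [he, hxn]; exact hpback
      · rw [he, hxn]
    | succ k ih =>
      intro hk
      obtain ⟨h1, h2⟩ := ih (by lia)
      have he : (n : ℤ) - 1 - (k + 1 : ℕ) + 1 = n - 1 - k := by push_cast; ring
      refine step _ ⟨by push_cast; lia, by push_cast; lia⟩ ⟨by push_cast; lia, by push_cast; lia⟩ ?_ ?_
      · rw [he]; exact h1
      · rw [he]; exact h2.le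
  have h1 := (main (n - 1) (by lia)).2
  have he : (n : ℤ) - 1 - (n - 1 : ℕ) = 0 := by lia
  rw [he, hx0] at h1
  exact lt_irrefl _ h1

theorem not_hasRescaledShadowing (h : IsLyapunovPair φ σ B L N a b C)
    (hφ : IsOrbitFlow φ S) (hS : IsClosed S) (hσ : σ ∈ S) {Λ : Set M}
    (hΛ : IsRChainRecurrentSet φ S Λ) (hatt : σ ∈ closure (Λ \ S)) :
    ¬ HasRescaledShadowing φ S Λ :=
  h.not_hasRescaledShadowing_of_exits hφ hS hσ hΛ.2.1
    (h.exists_exit_of_chainRecurrent hφ hS hσ hΛ hatt)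

end IsLyapunovPair

/-! ### A quadratic Lyapunov function for a hyperbolic linear field -/

section LinearLyapunov

open scoped RealInnerProductSpace

variable {E : Type*} [NormedAddCommGroup E] [InnerProductSpace ℝ E] [CompleteSpace E]

/-- The operator `∫₀ᵀ G(t)* G(t) dt` with `G(t) = exp(tA) P` is symmetric and solves the Lyapunov
equation with right-hand side `‖G(T) v‖² - ‖P v‖²`. -/
theorem exists_symmetric_inner_eq (A P : E →L[ℝ] E) (hP : Commute P A) (T : ℝ) :
    ∃ S : E →L[ℝ] E, (∀ v w, ⟪S v, w⟫ = ⟪v, S w⟫) ∧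
      ∀ v, 2 * ⟪S v, A v⟫ = ‖NormedSpace.exp (T • A) (P v)‖ ^ 2 - ‖P v‖ ^ 2 := by
  let G : ℝ → E →L[ℝ] E := fun t => NormedSpace.exp (t • A) * P
  -- As P commutes with A, the factor A can be moved to the right of G, so the derivative of ‖G v‖²
  -- pairs G v with G (A v).
  have hG : ∀ t, HasDerivAt G (G t * A) t := by
    intro t
    have h1 := (hasDerivAt_exp_smul_const (𝕂 := ℝ) A t).mul_const P
    have h2 : NormedSpace.exp (t • A) * A * P = G t * A := by
      simp only [G, mul_assoc, hP.eq]
    rwa [h2] at h1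
  have hGc : Continuous G := continuous_iff_continuousAt.2 fun t => (hG t).continuousAt
  have hGvc : ∀ v, Continuous fun t => G t v := fun v => hGc.clm_apply continuous_const
  let H : ℝ → E →L[ℝ] E := fun t => (ContinuousLinearMap.adjoint (G t)).comp (G t)
  have hHc : Continuous H :=
    ((ContinuousLinearMap.adjoint (𝕜 := ℝ) (E := E) (F := E)).continuous.comp hGc).clm_comp hGc
  have hform : ∀ v w, ⟪(∫ t in (0 : ℝ)..T, H t) v, w⟫ = ∫ t in (0 : ℝ)..T, ⟪G t v, G t w⟫ := by
    intro v w
    rw [ContinuousLinearMap.intervalIntegral_apply (hHc.intervalIntegrable _ _), real_inner_comm]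
    have h1 := (innerSL ℝ w).intervalIntegral_comp_comm
      ((hHc.clm_apply (continuous_const (y := v))).intervalIntegrable (μ := MeasureTheory.volume) 0 T)
    simp only [innerSL_apply_apply] at h1
    rw [← h1]
    refine intervalIntegral.integral_congr fun t _ => ?_
    simp only [H, ContinuousLinearMap.comp_apply]
    rw [ContinuousLinearMap.adjoint_inner_right, real_inner_comm]
  refine ⟨∫ t in (0 : ℝ)..T, H t, fun v w => ?_, fun v => ?_⟩
  · rw [hform, real_inner_comm, hform]
    exact intervalIntegral.integral_congr fun t _ => real_inner_comm _ _
  · rw [hform, ← intervalIntegral.integral_const_mul]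
    have hd : ∀ t, HasDerivAt (fun t => ⟪G t v, G t v⟫) (2 * ⟪G t v, G t (A v)⟫) t := by
      intro t
      have h1 : HasDerivAt (fun t => G t v) (G t (A v)) t := by
        simpa using (hG t).clm_apply (hasDerivAt_const t v)
      have h2 := h1.inner ℝ h1
      rwa [real_inner_comm (G t v) (G t (A v)), ← two_mul] at h2
    rw [intervalIntegral.integral_eq_sub_of_hasDerivAt (fun t _ => hd t)
      ((continuous_const.mul ((hGvc v).inner (hGvc (A v)))).intervalIntegrable _ _)]
    simp [G]

/-- Each half contributes at least (1/2)(1 - 1/4) = 3/8 times ‖P v‖² or ‖R v‖², after the sign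
change; with ‖v‖² ≤ 2(‖P v‖² + ‖R v‖²) this gives 3/16, more than needed. -/
theorem exists_lyapunov_form (A P R : E →L[ℝ] E) (hPA : Commute P A) (hRA : Commute R A)
    (hPR : ∀ v, P v + R v = v) (T : ℝ)
    (hs : ∀ v, ‖NormedSpace.exp (T • A) (P v)‖ ≤ 1 / 2 * ‖P v‖)
    (hu : ∀ v, ‖NormedSpace.exp ((-T) • A) (R v)‖ ≤ 1 / 2 * ‖R v‖) :
    ∃ S : E →L[ℝ] E, (∀ v w, ⟪S v, w⟫ = ⟪v, S w⟫) ∧ ∀ v, 1 / 8 * ‖v‖ ^ 2 ≤ ⟪S v, A v⟫ := by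
  obtain ⟨S₁, hS₁, hS₁'⟩ := exists_symmetric_inner_eq A P hPA T
  obtain ⟨S₂, hS₂, hS₂'⟩ := exists_symmetric_inner_eq A R hRA (-T)
  refine ⟨-(S₁ + S₂), fun v w => ?_, fun v => ?_⟩
  · simp [inner_add_left, inner_add_right, hS₁, hS₂]
  · have h1 := hS₁' v
    have h2 := hS₂' v
    have h3 : ‖v‖ ≤ ‖P v‖ + ‖R v‖ := by
      calc ‖v‖ = ‖P v + R v‖ := by rw [hPR]
        _ ≤ _ := norm_add_le _ _
    have h4 : ⟪(-(S₁ + S₂)) v, A v⟫ = -(⟪S₁ v, A v⟫ + ⟪S₂ v, A v⟫) := by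
      simp [inner_add_left]
    have h5 : ‖NormedSpace.exp (T • A) (P v)‖ ^ 2 ≤ (1 / 2 * ‖P v‖) ^ 2 :=
      pow_le_pow_left₀ (norm_nonneg _) (hs v) 2
    have h6 : ‖NormedSpace.exp ((-T) • A) (R v)‖ ^ 2 ≤ (1 / 2 * ‖R v‖) ^ 2 :=
      pow_le_pow_left₀ (norm_nonneg _) (hu v) 2
    have h7 : ‖v‖ ^ 2 ≤ (‖P v‖ + ‖R v‖) ^ 2 := pow_le_pow_left₀ (norm_nonneg _) h3 2
    rw [h4]
    nlinarith [sq_nonneg (‖P v‖ - ‖R v‖)]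

/-- A linear field with an invariant splitting into an exponentially contracted and an
exponentially expanded subspace has a quadratic Lyapunov function. -/
theorem exists_lyapunov_form_of_isCompl [FiniteDimensional ℝ E] (A : E →L[ℝ] E)
    (Es Eu : Submodule ℝ E) (hc : IsCompl Es Eu) (hEs : ∀ v ∈ Es, A v ∈ Es)
    (hEu : ∀ v ∈ Eu, A v ∈ Eu) (T : ℝ)
    (hs : ∀ v ∈ Es, ‖NormedSpace.exp (T • A) v‖ ≤ 1 / 2 * ‖v‖)
    (hu : ∀ v ∈ Eu, ‖NormedSpace.exp ((-T) • A) v‖ ≤ 1 / 2 * ‖v‖) :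
    ∃ S : E →L[ℝ] E, (∀ v w, ⟪S v, w⟫ = ⟪v, S w⟫) ∧ ∀ v, 1 / 8 * ‖v‖ ^ 2 ≤ ⟪S v, A v⟫ := by
  have hcomm : ∀ (p q : Submodule ℝ E) (h : IsCompl p q), (∀ v ∈ p, A v ∈ p) →
      (∀ v ∈ q, A v ∈ q) → Commute (Submodule.projection p q h).toContinuousLinearMap A := by
    intro p q h hp hq
    ext v : 1
    have hv := Submodule.projection_add_projection_eq_self h v
    simp only [mul_apply_eq_comp, LinearMap.coe_toContinuousLinearMap']
    -- Split v into its two components: A keeps each in its subspace, so the projection fixes one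
    -- image and kills the other.
    conv_lhs => rw [← hv, map_add, map_add]
    rw [Submodule.projection_apply_of_mem_left h (hp _ (Submodule.projection_apply_mem h v)),
      (Submodule.projection_apply_eq_zero_iff h).2
        (hq _ (Submodule.projection_apply_mem h.symm v)),
      add_zero]
  refine exists_lyapunov_form A (Submodule.projection Es Eu hc).toContinuousLinearMap
    (Submodule.projection Eu Es hc.symm).toContinuousLinearMap (hcomm _ _ _ hEs hEu)
    (hcomm _ _ _ hEu hEs) (fun v => ?_) T (fun v => hs _ ?_) (fun v => hu _ ?_)
  · exact Submodule.projection_add_projection_eq_self hc v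
  · exact Submodule.projection_apply_mem hc v
  · exact Submodule.projection_apply_mem hc.symm v

end LinearLyapunov

/-! ### From the linear form to the nonlinear flow -/

section LocalCoordinate

open scoped RealInnerProductSpace

variable {E : Type*} [NormedAddCommGroup E] [InnerProductSpace ℝ E]
  {M : Type*} [MetricSpace M] {φ : ℝ → M → M} {σ : M}

/-- In a local coordinate `u` in which the flow solves `u' = A u + o(u)`, a quadratic Lyapunov
function of `A` is a strict Lyapunov function of the flow near `σ`. -/
theorem exists_isLyapunovPair [LocallyCompactSpace M] {u f : M → E} {A S : E →L[ℝ] E} {U : Set M}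
    (hU : U ∈ 𝓝 σ) (hu : ContinuousOn u U) (hu0 : ∀ x ∈ U, u x = 0 ↔ x = σ)
    (hderiv : ∀ x t, φ t x ∈ U → HasDerivAt (fun s => u (φ s x)) (f (φ t x)) t)
    (hf : ∀ η > 0, ∀ᶠ x in 𝓝 σ, ‖f x - A (u x)‖ ≤ η * ‖u x‖)
    (hS : ∀ v w, ⟪S v, w⟫ = ⟪v, S w⟫) (hSA : ∀ v, 1 / 8 * ‖v‖ ^ 2 ≤ ⟪S v, A v⟫) :
    ∃ B L N a b C, IsLyapunovPair φ σ B L N a b C := by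
  have hS0 : 0 ≤ ‖S‖ := norm_nonneg S
  -- With this η the error in ⟪S u, u'⟫ is at most 1/16 ‖u‖², half of the linear gain 1/8 ‖u‖²; the
  -- derivative of ⟪S u, u⟫ doubles what is left, so a = 1/8.
  set η := 1 / (16 * (‖S‖ + 1)) with hη
  have hη0 : 0 < η := by positivity
  have hη1 : ‖S‖ * η ≤ 1 / 16 := by
    rw [hη, mul_one_div, div_le_div_iff₀ (by positivity) (by norm_num)]
    linarith
  have hη2 : η ≤ 1 := by
    rw [hη, div_le_one (by positivity)]
    linarith
  obtain ⟨B, hBσ, hBU, hB⟩ := local_compact_nhds (inter_mem hU (hf η hη0))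
  have hBU1 : B ⊆ U := hBU.trans inter_subset_left
  have hBf : ∀ x ∈ B, ‖f x - A (u x)‖ ≤ η * ‖u x‖ := fun x hx => (hBU hx).2
  have huB := hu.mono hBU1
  refine ⟨B, fun x => ⟪S (u x), u x⟫, fun x => ‖u x‖ ^ 2, 1 / 8, 2 * (‖A‖ + 1), ‖S‖ + 1,
    hB, hBσ, by norm_num, by positivity, by positivity,
    (S.continuous.comp_continuousOn huB).inner huB, huB.norm.pow 2, fun x _ => by positivity,
    fun x hx => ?_, fun x _ => ?_, fun x t hx => ?_, fun x t hx => ?_⟩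
  · rw [← hu0 x (hBU1 hx)]
    simp
  · calc |⟪S (u x), u x⟫| ≤ ‖S (u x)‖ * ‖u x‖ := abs_real_inner_le_norm _ _
      _ ≤ ‖S‖ * ‖u x‖ * ‖u x‖ := by gcongr; exact S.le_opNorm _
      _ ≤ (‖S‖ + 1) * ‖u x‖ ^ 2 := by nlinarith [sq_nonneg ‖u x‖]
  · have hd := hderiv x t (hBU1 hx)
    refine ⟨_, ((S.hasFDerivAt.comp_hasDerivAt t hd).inner ℝ hd), ?_⟩
    set y := φ t x
    have h1 : ⟪S (f y), u y⟫ = ⟪S (u y), f y⟫ := by rw [hS, real_inner_comm]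
    have h2 : ⟪S (u y), f y⟫ = ⟪S (u y), A (u y)⟫ + ⟪S (u y), f y - A (u y)⟫ := by
      rw [← inner_add_right, add_sub_cancel]
    have h3 : |⟪S (u y), f y - A (u y)⟫| ≤ 1 / 16 * ‖u y‖ ^ 2 := by
      calc |⟪S (u y), f y - A (u y)⟫| ≤ ‖S (u y)‖ * ‖f y - A (u y)‖ := abs_real_inner_le_norm _ _
        _ ≤ ‖S‖ * ‖u y‖ * (η * ‖u y‖) := by
          gcongr
          · exact S.le_opNorm _
          · exact hBf y hx
        _ = ‖S‖ * η * ‖u y‖ ^ 2 := by ring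
        _ ≤ _ := by gcongr
    have h4 := hSA (u y)
    have h5 := (abs_le.1 h3).1
    simp only [Function.comp_apply]
    linarith
  · have hd := hderiv x t (hBU1 hx)
    refine ⟨_, hd.norm_sq, ?_⟩
    set y := φ t x
    have h1 : ‖f y‖ ≤ (‖A‖ + 1) * ‖u y‖ := by
      calc ‖f y‖ = ‖A (u y) + (f y - A (u y))‖ := by rw [add_sub_cancel]
        _ ≤ ‖A (u y)‖ + ‖f y - A (u y)‖ := norm_add_le _ _
        _ ≤ ‖A‖ * ‖u y‖ + 1 * ‖u y‖ := by
          gcongr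
          · exact A.le_opNorm _
          · exact (hBf y hx).trans (by gcongr)
        _ = _ := by ring
    rw [abs_mul, abs_of_pos (two_pos : (0 : ℝ) < 2)]
    calc 2 * |⟪u y, f y⟫| ≤ 2 * (‖u y‖ * ‖f y‖) := by gcongr; exact abs_real_inner_le_norm _ _
      _ ≤ 2 * (‖u y‖ * ((‖A‖ + 1) * ‖u y‖)) := by gcongr
      _ = _ := by ring

end LocalCoordinate

/-! ### The flow of a vector field near a hyperbolic singularity -/

section VectorFieldFlow

variable {n : ℕ} {M : Type*} [MetricSpace M] [ChartedSpace (EuclideanSpace ℝ (Fin n)) M]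

theorem isMIntegralCurve_flow {X : (x : M) → TangentSpace (𝓡 n) x} (hc : IsComplete X) (x : M) :
    IsMIntegralCurve (fun t => flow X hc t x) X := (hc x).choose_spec.2

theorem flow_zero {X : (x : M) → TangentSpace (𝓡 n) x} (hc : IsComplete X) (x : M) :
    flow X hc 0 x = x := (hc x).choose_spec.1

/-- The Riemannian norm of `T_σ M` is equivalent to the norm of `ℝⁿ`. -/
theorem exists_norm_equiv [RiemannianBundle (fun x : M => TangentSpace (𝓡 n) x)] (σ : M) :
    ∃ K > 0, ∀ v : TangentSpace (𝓡 n) σ,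
    ‖v‖ ≤ K * ‖(show EuclideanSpace ℝ (Fin n) from v)‖ ∧
      ‖(show EuclideanSpace ℝ (Fin n) from v)‖ ≤ K * ‖v‖ := by
  let ι : TangentSpace (𝓡 n) σ →L[ℝ] EuclideanSpace ℝ (Fin n) :=
    ContinuousLinearMap.id ℝ (EuclideanSpace ℝ (Fin n))
  let κ : EuclideanSpace ℝ (Fin n) →L[ℝ] TangentSpace (𝓡 n) σ :=
    ContinuousLinearMap.id ℝ (EuclideanSpace ℝ (Fin n))
  refine ⟨‖ι‖ + ‖κ‖ + 1, by positivity, fun v => ⟨?_, ?_⟩⟩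
  · refine (κ.le_opNorm v).trans ?_
    exact mul_le_mul_of_nonneg_right (by linarith [norm_nonneg ι, norm_nonneg κ]) (norm_nonneg _)
  · refine (ι.le_opNorm v).trans ?_
    exact mul_le_mul_of_nonneg_right (by linarith [norm_nonneg ι, norm_nonneg κ]) (norm_nonneg _)

variable [IsManifold (𝓡 n) ∞ M]

/-- `flow` is assembled from chosen integral curves, so the group law and the constancy at
singularities rest on uniqueness for C^1 fields. -/
theorem isOrbitFlow_flow {X : (x : M) → TangentSpace (𝓡 n) x}
    (hX : ContMDiff (𝓡 n) (𝓡 n).tangent 1 (fun x => (⟨x, X x⟩ : TangentBundle (𝓡 n) M)))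
    (hc : IsComplete X) : IsOrbitFlow (flow X hc) (Sing X) := by
  refine ⟨flow_zero hc, fun s t x => ?_, fun x => (isMIntegralCurve_flow hc x).continuous,
    fun x hx t => ?_⟩
  · have h1 := (isMIntegralCurve_flow hc x).comp_add t
    have h2 := isMIntegralCurve_Ioo_eq_of_contMDiff_boundaryless (t₀ := 0) hX
      (isMIntegralCurve_flow hc (flow X hc t x)) h1 (by simp [flow_zero])
    exact congrFun h2 s
  · have h2 := isMIntegralCurve_Ioo_eq_of_contMDiff_boundaryless (t₀ := 0) hX
      (isMIntegralCurve_flow hc x) (isMIntegralCurve_const hx) (flow_zero hc x)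
    exact congrFun h2 t

/-- A vector field read in the trivialization of the tangent bundle at `σ`. -/
noncomputable def localRep (X : (x : M) → TangentSpace (𝓡 n) x) (σ x : M) :
    EuclideanSpace ℝ (Fin n) :=
  (trivializationAt (EuclideanSpace ℝ (Fin n)) (TangentSpace (𝓡 n) : M → Type _) σ
    (⟨x, X x⟩ : TangentBundle (𝓡 n) M)).2

/-- The linearization at `σ` as an operator of `ℝⁿ`. -/
noncomputable def linearOperator (X : (x : M) → TangentSpace (𝓡 n) x) (σ : M) :
    EuclideanSpace ℝ (Fin n) →L[ℝ] EuclideanSpace ℝ (Fin n) := linearization X σ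

/-- Over the chart domain the trivialization at σ acts on fibres as the derivative of the chart.
Thus `localRep` is the velocity field of the flow read in the chart. -/
theorem localRep_eq_mfderiv (X : (x : M) → TangentSpace (𝓡 n) x) {σ x : M}
    (hx : x ∈ (chartAt (EuclideanSpace ℝ (Fin n)) σ).source) :
    localRep X σ x =
      mfderiv (𝓡 n) 𝓘(ℝ, EuclideanSpace ℝ (Fin n)) (extChartAt (𝓡 n) σ) x (X x) := by
  have h1 : (trivializationAt (EuclideanSpace ℝ (Fin n)) (TangentSpace (𝓡 n) : M → Type _)
      σ).continuousLinearMapAt ℝ x (X x) = localRep X σ x := by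
    rw [Trivialization.continuousLinearMapAt_apply, Trivialization.coe_linearMapAt_of_mem]
    · rfl
    · simpa using hx
  exact h1.symm.trans
    (DFunLike.congr_fun (TangentBundle.continuousLinearMapAt_trivializationAt hx) (X x))

theorem localRep_self_of_mem_sing {X : (x : M) → TangentSpace (𝓡 n) x} {σ : M}
    (hσ : σ ∈ Sing X) : localRep X σ σ = 0 := by
  have h1 : X σ = 0 := hσ
  have h2 := localRep_eq_mfderiv X (mem_chart_source (EuclideanSpace ℝ (Fin n)) σ)
  rw [h1] at h2
  exact h2.trans (map_zero _)

theorem hasDerivAt_extChartAt_flow {X : (x : M) → TangentSpace (𝓡 n) x} (hc : IsComplete X)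
    {σ x : M} {t : ℝ}
    (hx : flow X hc t x ∈ (chartAt (EuclideanSpace ℝ (Fin n)) σ).source) :
    HasDerivAt (fun s => extChartAt (𝓡 n) σ (flow X hc s x)) (localRep X σ (flow X hc t x)) t := by
  let D : EuclideanSpace ℝ (Fin n) →L[ℝ] EuclideanSpace ℝ (Fin n) :=
    mfderiv (𝓡 n) 𝓘(ℝ, EuclideanSpace ℝ (Fin n)) (extChartAt (𝓡 n) σ) (flow X hc t x)
  let v : EuclideanSpace ℝ (Fin n) := X (flow X hc t x)
  have h1 : HasFDerivAt (fun s => extChartAt (𝓡 n) σ (flow X hc s x))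
      (D.comp ((1 : ℝ →L[ℝ] ℝ).smulRight v)) t :=
    ((mdifferentiableAt_extChartAt (I := 𝓡 n) hx).hasMFDerivAt.comp t
      (isMIntegralCurve_flow hc x t)).hasFDerivAt
  have h2 : (D.comp ((1 : ℝ →L[ℝ] ℝ).smulRight v)) 1 = localRep X σ (flow X hc t x) := by
    have h3 : D v = localRep X σ (flow X hc t x) := (localRep_eq_mfderiv X hx).symm
    simpa using h3
  exact h2 ▸ h1.hasDerivAt

theorem linearOperator_eq_mfderiv (X : (x : M) → TangentSpace (𝓡 n) x) (σ : M) :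
    linearOperator X σ =
      mfderiv (𝓡 n) 𝓘(ℝ, EuclideanSpace ℝ (Fin n)) (localRep X σ) σ := by
  have h1 : ∀ v : EuclideanSpace ℝ (Fin n),
      (trivializationAt (EuclideanSpace ℝ (Fin n)) (TangentSpace (𝓡 n) : M → Type _)
        σ).symmL ℝ σ v = v := by
    intro v
    rw [TangentBundle.symmL_trivializationAt_eq_core (mem_chart_source _ σ)]
    exact tangentCoordChange_self (I := 𝓡 n) (mem_extChartAt_source σ)
  exact ContinuousLinearMap.ext fun v => h1 _

/-- First-order Taylor expansion in the chart; the constant term vanishes because σ is a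
singularity. -/
theorem localRep_approx {X : (x : M) → TangentSpace (𝓡 n) x}
    (hX : ContMDiff (𝓡 n) (𝓡 n).tangent 1 (fun x => (⟨x, X x⟩ : TangentBundle (𝓡 n) M)))
    {σ : M} (hσ : σ ∈ Sing X) {η : ℝ} (hη : 0 < η) :
    ∀ᶠ x in 𝓝 σ, ‖localRep X σ x - linearOperator X σ
        (extChartAt (𝓡 n) σ x - extChartAt (𝓡 n) σ σ)‖ ≤
      η * ‖extChartAt (𝓡 n) σ x - extChartAt (𝓡 n) σ σ‖ := by
  have hm : MDifferentiableAt (𝓡 n) 𝓘(ℝ, EuclideanSpace ℝ (Fin n)) (localRep X σ) σ :=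
    ((Bundle.contMDiffAt_section σ).1 (hX σ)).mdifferentiableAt one_ne_zero
  have h1 : HasFDerivAt (localRep X σ ∘ (extChartAt (𝓡 n) σ).symm) (linearOperator X σ)
      (extChartAt (𝓡 n) σ σ) := by
    let D : EuclideanSpace ℝ (Fin n) →L[ℝ] EuclideanSpace ℝ (Fin n) :=
      mfderiv (𝓡 n) 𝓘(ℝ, EuclideanSpace ℝ (Fin n)) (localRep X σ) σ
    have h2 : HasFDerivWithinAt (localRep X σ ∘ (extChartAt (𝓡 n) σ).symm) D (range (𝓡 n))
        (extChartAt (𝓡 n) σ σ) := hm.hasMFDerivAt.2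
    rw [ModelWithCorners.range_eq_univ, hasFDerivWithinAt_univ] at h2
    rwa [show linearOperator X σ = D from linearOperator_eq_mfderiv X σ]
  have h3 := (continuousAt_extChartAt (I := 𝓡 n) σ).eventually (h1.isLittleO.def hη)
  filter_upwards [h3, extChartAt_source_mem_nhds (I := 𝓡 n) σ] with x hx hxs
  rwa [Function.comp_apply, Function.comp_apply, (extChartAt (𝓡 n) σ).left_inv hxs,
    (extChartAt (𝓡 n) σ).left_inv (mem_extChartAt_source σ), localRep_self_of_mem_sing hσ,
    sub_zero] at hx

variable [RiemannianBundle (fun x : M => TangentSpace (𝓡 n) x)]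

theorem isClosed_sing
    [IsContMDiffRiemannianBundle (𝓡 n) ∞ (EuclideanSpace ℝ (Fin n))
      (fun x : M => TangentSpace (𝓡 n) x)] {X : (x : M) → TangentSpace (𝓡 n) x}
    (hX : ContMDiff (𝓡 n) (𝓡 n).tangent 1 (fun x => (⟨x, X x⟩ : TangentBundle (𝓡 n) M))) :
    IsClosed (Sing X) := by
  have : IsContMDiffRiemannianBundle (𝓡 n) 1 (EuclideanSpace ℝ (Fin n))
      (TangentSpace (𝓡 n) : M → Type _) :=
    IsContMDiffRiemannianBundle.of_le (n := ∞)
      (E := fun x : M => TangentSpace (𝓡 n) x) (mod_cast le_top)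
  have h1 : Continuous fun x => inner ℝ (X x) (X x) := (hX.inner_bundle hX).continuous
  have h2 : Sing X = {x | inner ℝ (X x) (X x) = 0} := by
    ext x
    exact inner_self_eq_zero.symm
  rw [h2]
  exact isClosed_eq h1 continuous_const

/-- Rescaled shadowing fails on an `R`-chain-recurrent set with an attached hyperbolic singularity.
As the durations of a pseudo-orbit are unbounded and its jumps are measured at the starting points
of the pieces, no control of the homoclinic loops is needed. -/
theorem not_hasRescaledShadowing_of_hyperbolic
    [IsContMDiffRiemannianBundle (𝓡 n) ∞ (EuclideanSpace ℝ (Fin n))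
      (fun x : M => TangentSpace (𝓡 n) x)] {X : (x : M) → TangentSpace (𝓡 n) x}
    (hX : ContMDiff (𝓡 n) (𝓡 n).tangent 1 (fun x => (⟨x, X x⟩ : TangentBundle (𝓡 n) M)))
    (hc : IsComplete X) {Λ : Set M} (hΛ : IsRChainRecurrentSet (flow X hc) (Sing X) Λ) {σ : M}
    (hatt : IsAttached X Λ σ) (hhyp : IsHyperbolicSing X σ) :
    ¬ HasRescaledShadowing (flow X hc) (Sing X) Λ := by
  obtain ⟨hσ, Es, Eu, hsplit⟩ := hhyp
  obtain ⟨D, hD, lam, hlam, hexp⟩ := hsplit.exponential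
  obtain ⟨K, hK, hnorm⟩ := exists_norm_equiv (n := n) σ
  -- Passing between the Riemannian and the Euclidean norm costs a factor K * K, absorbed by taking
  -- T large.
  have hlim : Tendsto (fun t : ℝ => K * K * D * Real.exp (-lam * t)) atTop (𝓝 0) := by
    have h1 : Tendsto (fun t : ℝ => -lam * t) atTop atBot :=
      tendsto_id.const_mul_atTop_of_neg (by linarith)
    simpa using (Real.tendsto_exp_atBot.comp h1).const_mul (K * K * D)
  obtain ⟨T, hT0, hT⟩ := ((eventually_ge_atTop (0 : ℝ)).and
    (hlim.eventually (gt_mem_nhds (show (0 : ℝ) < 1 / 2 by norm_num)))).exists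
  have hcontr : ∀ v w : TangentSpace (𝓡 n) σ, ‖w‖ ≤ D * Real.exp (-lam * T) * ‖v‖ →
      ‖(show EuclideanSpace ℝ (Fin n) from w)‖ ≤
        1 / 2 * ‖(show EuclideanSpace ℝ (Fin n) from v)‖ := by
    intro v w hvw
    have hv := norm_nonneg (show EuclideanSpace ℝ (Fin n) from v)
    calc ‖(show EuclideanSpace ℝ (Fin n) from w)‖ ≤ K * ‖w‖ := (hnorm w).2
      _ ≤ K * (D * Real.exp (-lam * T) * (K * ‖(show EuclideanSpace ℝ (Fin n) from v)‖)) := by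
        refine mul_le_mul_of_nonneg_left (hvw.trans ?_) hK.le
        exact mul_le_mul_of_nonneg_left (hnorm v).1 (by positivity)
      _ = K * K * D * Real.exp (-lam * T) * ‖(show EuclideanSpace ℝ (Fin n) from v)‖ := by ring
      _ ≤ _ := mul_le_mul_of_nonneg_right hT.le hv
  obtain ⟨S, hS, hSA⟩ := exists_lyapunov_form_of_isCompl (linearOperator X σ) Es Eu hsplit.isCompl
    hsplit.invariant_stable hsplit.invariant_unstable T
    (fun v hv => hcontr v _ ((hexp T hT0).1 v hv)) (fun v hv => hcontr v _ ((hexp T hT0).2 v hv))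
  have : LocallyCompactSpace M :=
    ChartedSpace.locallyCompactSpace (EuclideanSpace ℝ (Fin n)) M
  obtain ⟨B, L, N, a, b, C, h⟩ := exists_isLyapunovPair (φ := flow X hc) (σ := σ)
    (u := fun x => extChartAt (𝓡 n) σ x - extChartAt (𝓡 n) σ σ) (f := localRep X σ)
    (U := (extChartAt (𝓡 n) σ).source) (extChartAt_source_mem_nhds σ)
    ((continuousOn_extChartAt σ).sub continuousOn_const)
    (fun x hx => by
      rw [sub_eq_zero]
      exact (extChartAt (𝓡 n) σ).injOn.eq_iff hx (mem_extChartAt_source σ))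
    (fun x t hx => (hasDerivAt_extChartAt_flow hc (by rwa [extChartAt_source] at hx)).sub_const _)
    (fun η hη => localRep_approx hX hσ hη) hS hSA
  exact h.not_hasRescaledShadowing (isOrbitFlow_flow hX hc) (isClosed_sing hX) hσ hΛ hatt.2

end VectorFieldFlow

end RescaledShadowing

theorem theoremD {n : ℕ} {M : Type*} [MetricSpace M]
    [ChartedSpace (EuclideanSpace ℝ (Fin n)) M] [IsManifold (𝓡 n) ∞ M]
    [RiemannianBundle (fun x : M => TangentSpace (𝓡 n) x)]
    [IsContMDiffRiemannianBundle (𝓡 n) ∞ (EuclideanSpace ℝ (Fin n))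
      (fun x : M => TangentSpace (𝓡 n) x)]
    [IsRiemannianManifold (𝓡 n) M]
    (X : (x : M) → TangentSpace (𝓡 n) x)
    (hX : ContMDiff (𝓡 n) (𝓡 n).tangent 1 (fun x => (⟨x, X x⟩ : TangentBundle (𝓡 n) M)))
    (hc : RescaledShadowing.IsComplete X)
    (Λ : Set M)
    (hΛ : RescaledShadowing.IsRChainRecurrentSet (RescaledShadowing.flow X hc)
      (RescaledShadowing.Sing X) Λ) :
    ((∃ σ ∈ Λ, RescaledShadowing.IsAttached X Λ σ ∧ RescaledShadowing.IsHyperbolicSing X σ ∧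
        ∀ V : Set M,
          RescaledShadowing.IsAdaptedNhd (RescaledShadowing.flow X hc)
            (RescaledShadowing.Sing X) σ V →
          ∃ N : ℕ, 0 < N ∧
            ∀ p ∈ RescaledShadowing.HL (RescaledShadowing.flow X hc)
                (RescaledShadowing.Sing X) σ,
              RescaledShadowing.crossingNumber (RescaledShadowing.flow X hc) V p ≤ N) →
      ¬ RescaledShadowing.HasRescaledShadowing (RescaledShadowing.flow X hc)
          (RescaledShadowing.Sing X) Λ) ∧
    ((∃ σ ∈ Λ, RescaledShadowing.IsAttached X Λ σ ∧
        RescaledShadowing.IsIndexOneHyperbolicSing X σ) →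
      ¬ RescaledShadowing.HasRescaledShadowing (RescaledShadowing.flow X hc)
          (RescaledShadowing.Sing X) Λ) ∧
    ((n ≤ 3 ∧ ∃ σ ∈ Λ, RescaledShadowing.IsAttached X Λ σ ∧
        RescaledShadowing.IsHyperbolicSing X σ) →
      ¬ RescaledShadowing.HasRescaledShadowing (RescaledShadowing.flow X hc)
          (RescaledShadowing.Sing X) Λ) := by
  refine ⟨?_, ?_, ?_⟩
  · rintro ⟨σ, -, hatt, hhyp, -⟩
    exact RescaledShadowing.not_hasRescaledShadowing_of_hyperbolic hX hc hΛ hatt hhyp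
  · rintro ⟨σ, -, hatt, hσ, Es, Eu, hsplit, -⟩
    exact RescaledShadowing.not_hasRescaledShadowing_of_hyperbolic hX hc hΛ hatt
      ⟨hσ, Es, Eu, hsplit⟩
  · rintro ⟨-, σ, -, hatt, hhyp⟩
    exact RescaledShadowing.not_hasRescaledShadowing_of_hyperbolic hX hc hΛ hatt hhyp
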